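/- Let $1\le r\le k\le n$ be integers, and let $V\in\mathbb R^{k\times r}$ satisfy $\|V\|_F=1$ and $(VV^{\top})_{ij}>0$ for all $i,j$. Let $\mathcal X_V$ be the set of all entrywise nonnegative $X\in\mathbb R^{n\times k}$ whose columns $x_1,\dots,x_k$ have Euclidean norm $1$ and which satisfy $\|XV\|_F=1$. Let $f:\mathbb R^{n\times k}\to\mathbb R$ be twice continuously differentiable, and let $\bar X\in\mathcal X_V$ be a local minimizer of the problem $\min_{X\in\mathcal X_V} f(X)$. Let $L(X,\Lambda,Z,\lambda)=f(X)-\sum_{j}\Lambda_j(\|x_j\|^2-1)-\langle Z,X\rangle+\lambda(\|XV\|_F-1)$, where $\langle A,B\rangle=\mathrm{tr}(A^{\top}B)$, and call $(\bar\Lambda,\bar Z,\bar\lambda)\in\mathbb R^k\times\mathbb R^{n\times k}\times\mathbb R$ Lagrange multipliers at $\bar X$ if $\bar Z\ge 0$, $\bar X_{ij}\bar Z_{ij}=0$ for all $i,j$, and $\nabla_X L(\bar X,\bar\Lambda,\bar Z,\bar\lambda)=0$. For such $\bar Z$, let $\mathcal N_{\mathcal X_V}(\bar X,\bar Z)$ be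 the set of all $D\in\mathbb R^{n\times k}$ for which there are $\alpha^l>0$ with $\alpha^l\to0$ and $D^l\to D$ such that, for every $l$, $X^l:=\bar X+\alpha^lD^l\in\mathcal X_V$, and $X^l_{ij}=0$ whenever $\bar Z_{ij}>0$ and $X^l_{ij}\ge0$ whenever $\bar Z_{ij}=0$. Then Lagrange multipliers at $\bar X$ exist; the set $\mathcal N_{\mathcal X_V}(\bar X,\bar Z)$ is the same for all Lagrange multipliers at $\bar X$, and is denoted by $\mathcal N_{\mathcal X_V}(\bar X)$ (the cone of sequential null constraint directions); and $$\langle D,\mathrm{Hess}\,f(\bar X)[D]\rangle\ge 0\qquad\text{for all } D\in\mathcal N_{\mathcal X_V}(\bar X),$$ where $\mathrm{Hess}\,f(X)[D]=\nabla^2f(X)[D]-D\,\mathrm{Diag}\big(X^{\top}\nabla f(X)\big)$ is the Riemannian Hessian with respect to the oblique manifold (the manifold of matrices with unit columns), and $\mathrm{Diag}(A)$ denotes the diagonal matrix with the same main diagonal as $A$. -/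

import Mathlib

open Filter Topology

namespace NonnegOrth

noncomputable section

/-- The space of real `n × k` matrices with the Frobenius inner product `⟨A, B⟩ = tr (Aᵀ B)` and
the Frobenius norm; the `(i, j)` entry of `A` is `A (i, j)`. -/
abbrev RMat (n k : ℕ) : Type := EuclideanSpace ℝ (Fin n × Fin k)

/-- The underlying matrix of an element of `RMat n k`. -/
def toMat {n k : ℕ} (X : RMat n k) : Matrix (Fin n) (Fin k) ℝ :=
  Matrix.of fun i j => X (i, j)

/-- A matrix regarded as an element of `RMat n k`. -/
def ofMat {n k : ℕ} (A : Matrix (Fin n) (Fin k) ℝ) : RMat n k :=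
  WithLp.toLp 2 fun p => A p.1 p.2

/-- The inner product of `RMat n k` is the Frobenius inner product. -/
theorem inner_eq_trace {n k : ℕ} (A B : RMat n k) :
    inner ℝ A B = ((toMat A).transpose * toMat B).trace := by
  simp only [PiLp.inner_apply, Fintype.sum_prod_type, Matrix.trace, Matrix.diag_apply,
    Matrix.mul_apply, Matrix.transpose_apply, toMat, Matrix.of_apply]
  rw [Finset.sum_comm]
  simp [mul_comm]

/-- The `j`-th column of `X`, as a Euclidean vector. -/
def col {n k : ℕ} (X : RMat n k) (j : Fin k) : EuclideanSpace ℝ (Fin n) :=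
  WithLp.toLp 2 fun i => X (i, j)

/-- The matrix product `X V`. -/
def mulMat {n k r : ℕ} (X : RMat n k) (V : RMat k r) : RMat n r :=
  ofMat (toMat X * toMat V)

/-- The nonnegative part of the oblique manifold: entrywise nonnegative matrices all of whose
columns have unit Euclidean norm. -/
def obliquePlus (n k : ℕ) : Set (RMat n k) :=
  {X | ∀ j, ‖col X j‖ = 1 ∧ ∀ i, 0 ≤ X (i, j)}

/-- The feasible set of the reformulation. -/
def feasibleSet {n k r : ℕ} (V : RMat k r) : Set (RMat n k) :=
  {X | X ∈ obliquePlus n k ∧ ‖mulMat X V‖ = 1}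

/-- The Euclidean Hessian of `f` at `X` applied to `D`: the derivative of the gradient of `f`
at `X` in the direction `D`. -/
def ehess {n k : ℕ} (f : RMat n k → ℝ) (X D : RMat n k) : RMat n k :=
  fderiv ℝ (gradient f) X D

/-- The Riemannian Hessian with respect to the oblique manifold,
`∇²f(X)[D] - D Diag(Xᵀ ∇f(X))`, where `Diag` keeps only the main diagonal of a square matrix. -/
def rhess {n k : ℕ} (f : RMat n k → ℝ) (X D : RMat n k) : RMat n k :=
  ehess f X D -
    ofMat (toMat D *
      Matrix.diagonal (Matrix.diag ((toMat X).transpose * toMat (gradient f X))))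

/-- The Lagrangian of the reformulation, with multipliers `Λ` for `‖x_j‖² = 1`, `Z` for `X ≥ 0`
and `lam` for `‖X V‖ = 1`. -/
def lagrangian {n k r : ℕ} (f : RMat n k → ℝ) (V : RMat k r)
    (Λ : Fin k → ℝ) (Z : RMat n k) (lam : ℝ) (X : RMat n k) : ℝ :=
  f X - ∑ j, Λ j * (‖col X j‖ ^ 2 - 1) - inner ℝ Z X + lam * (‖mulMat X V‖ - 1)

/-- `(Λ, Z, lam)` are Lagrange multipliers at `X`: `0 ≤ X ⊥ Z ≥ 0`, and the Lagrangian has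
zero gradient in its matrix variable at `X`. -/
structure IsLagrangeMultiplier {n k r : ℕ} (f : RMat n k → ℝ) (V : RMat k r) (X : RMat n k)
    (Λ : Fin k → ℝ) (Z : RMat n k) (lam : ℝ) : Prop where
  primal_nonneg : ∀ i j, 0 ≤ X (i, j)
  dual_nonneg : ∀ i j, 0 ≤ Z (i, j)
  complementary : ∀ i j, X (i, j) * Z (i, j) = 0
  stationary : HasGradientAt (lagrangian f V Λ Z lam) 0 X

/-- The sequential null constraint directions at `X` with respect to the multiplier matrix `Z` of
the constraint `X ≥ 0`. -/
def seqNullDirAt {n k r : ℕ} (V : RMat k r) (X Z : RMat n k) : Set (RMat n k) :=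
  {D | ∃ (α : ℕ → ℝ) (Ds : ℕ → RMat n k),
    (∀ l, 0 < α l) ∧ Tendsto α atTop (𝓝 0) ∧ Tendsto Ds atTop (𝓝 D) ∧
    ∀ l, X + α l • Ds l ∈ feasibleSet V ∧
      ∀ i j, (0 < Z (i, j) → (X + α l • Ds l) (i, j) = 0) ∧
        (Z (i, j) = 0 → 0 ≤ (X + α l • Ds l) (i, j))}

/-- The sequential null constraint directions at `X`: those with respect to some Lagrange
multiplier at `X`. (At a local minimizer every multiplier yields the same set.) -/
def seqNullDir {n k r : ℕ} (f : RMat n k → ℝ) (V : RMat k r) (X : RMat n k) : Set (RMat n k) :=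
  {D | ∃ (Λ : Fin k → ℝ) (Z : RMat n k) (lam : ℝ),
    IsLagrangeMultiplier f V X Λ Z lam ∧ D ∈ seqNullDirAt V X Z}

end

end NonnegOrth

namespace NonnegOrth

/-! Since `V * Vᵀ` is entrywise positive, `‖X V‖ = 1` forces the supports of the nonnegative unit
columns to be disjoint (`mem_feasibleSet_iff`). Perturbing one entry and renormalizing its column
gives stationarity on the support and a nonnegative gradient on zero rows. At the remaining zero
entries a large `lam` makes `Z` nonnegative, so multipliers exist.

On zero rows `Z` must equal the gradient; on nonzero rows feasible points near `X` keep the zero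
entries of `X`, whatever `Z` is. Hence the null directions do not depend on the multiplier.

Along `X + α D` from a null sequence, `⟨∇f, D⟩` reduces to `∑ c_j ⟨x_j, d_j⟩` with `c_j = ⟨x_j,
∇f_j⟩`, and unit norms turn `α ⟨x_j, d_j⟩` into exactly `-α² ‖d_j‖² / 2`. This is the `Diag` term of
the Riemannian Hessian; Taylor expansion supplies the rest. -/

/-! ### The feasible set in coordinates. -/

theorem norm_mulMat_sq {n k r : ℕ} (X : RMat n k) (V : RMat k r) :
    ‖mulMat X V‖ ^ 2 =
      ∑ i, ∑ j, ∑ j', X (i, j) * X (i, j') * (toMat V * (toMat V).transpose) j j' := by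
  rw [EuclideanSpace.real_norm_sq_eq, Fintype.sum_prod_type]
  refine Finset.sum_congr rfl fun i _ => ?_
  simp only [mulMat, ofMat, toMat, Matrix.mul_apply, Matrix.of_apply, Matrix.transpose_apply,
    pow_two]
  simp_rw [Finset.sum_mul_sum, Finset.mul_sum]
  rw [Finset.sum_comm]
  refine Finset.sum_congr rfl fun j _ => ?_
  rw [Finset.sum_comm]
  refine Finset.sum_congr rfl fun j' _ => Finset.sum_congr rfl fun a _ => ?_
  ring

theorem norm_col_sq {n k : ℕ} (X : RMat n k) (j : Fin k) :
    ‖col X j‖ ^ 2 = ∑ i, X (i, j) ^ 2 := by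
  rw [EuclideanSpace.real_norm_sq_eq]; rfl

theorem sum_gram_diag {k r : ℕ} (V : RMat k r) :
    ∑ j, (toMat V * (toMat V).transpose) j j = ‖V‖ ^ 2 := by
  rw [EuclideanSpace.real_norm_sq_eq, Fintype.sum_prod_type]
  simp [Matrix.mul_apply, toMat, pow_two]

/-- With unit columns the diagonal terms add up to the trace of `V * Vᵀ`, which is `‖V‖ ^ 2 = 1`. -/
theorem norm_mulMat_sq_sub_one {n k r : ℕ} {V : RMat k r} (hV : ‖V‖ = 1) {X : RMat n k}
    (hX : ∀ j, ‖col X j‖ = 1) :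
    ‖mulMat X V‖ ^ 2 - 1 = ∑ i, ∑ j, ∑ j', if j = j' then 0 else
      X (i, j) * X (i, j') * (toMat V * (toMat V).transpose) j j' := by
  have h1 : ∑ i, ∑ j, X (i, j) ^ 2 * (toMat V * (toMat V).transpose) j j = 1 := by
    rw [Finset.sum_comm]
    simp_rw [← Finset.sum_mul, ← norm_col_sq, hX]
    simp [sum_gram_diag, hV]
  rw [norm_mulMat_sq, ← h1, ← Finset.sum_sub_distrib]
  refine Finset.sum_congr rfl fun i _ => ?_
  rw [← Finset.sum_sub_distrib]
  refine Finset.sum_congr rfl fun j _ => ?_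
  rw [sub_eq_iff_eq_add]
  have : X (i, j) ^ 2 * (toMat V * (toMat V).transpose) j j = ∑ j', if j = j' then
      X (i, j) * X (i, j') * (toMat V * (toMat V).transpose) j j' else 0 := by
    simp [pow_two]
  rw [this, ← Finset.sum_add_distrib]
  refine Finset.sum_congr rfl fun j' _ => ?_
  split_ifs <;> simp

/-- The feasible matrices are the nonnegative matrices with orthonormal columns: unit columns, and
at most one nonzero entry in each row. -/
theorem mem_feasibleSet_iff {n k r : ℕ} {V : RMat k r} (hV : ‖V‖ = 1)
    (hVpos : ∀ i j, 0 < (toMat V * (toMat V).transpose) i j) {X : RMat n k} :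
    X ∈ feasibleSet V ↔
      X ∈ obliquePlus n k ∧ ∀ i j j', j ≠ j' → X (i, j) * X (i, j') = 0 := by
  refine and_congr_right fun hX => ?_
  have key := norm_mulMat_sq_sub_one hV (fun j => (hX j).1)
  have hterm : ∀ i j j', 0 ≤ if j = j' then 0 else
      X (i, j) * X (i, j') * (toMat V * (toMat V).transpose) j j' := by
    intro i j j'
    split_ifs
    · exact le_rfl
    · exact mul_nonneg (mul_nonneg ((hX j).2 i) ((hX j').2 i)) (hVpos j j').le
  constructor
  · intro h i j j' hne
    rw [h, one_pow, sub_self, eq_comm, Finset.sum_eq_zero_iff_of_nonneg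
      (fun i _ => Finset.sum_nonneg fun j _ => Finset.sum_nonneg fun j' _ => hterm i j j')] at key
    have k1 := key i (Finset.mem_univ _)
    rw [Finset.sum_eq_zero_iff_of_nonneg
      (fun j _ => Finset.sum_nonneg fun j' _ => hterm i j j')] at k1
    have k2 := k1 j (Finset.mem_univ _)
    rw [Finset.sum_eq_zero_iff_of_nonneg (fun j' _ => hterm i j j')] at k2
    have k3 := k2 j' (Finset.mem_univ _)
    rw [if_neg hne] at k3
    exact (mul_eq_zero.1 k3).resolve_right (hVpos j j').ne'
  · intro h
    have : ‖mulMat X V‖ ^ 2 - 1 = 0 := by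
      rw [key]
      refine Finset.sum_eq_zero fun i _ => Finset.sum_eq_zero fun j _ =>
        Finset.sum_eq_zero fun j' _ => ?_
      split_ifs with hj
      · rfl
      · rw [h i j j' hj, zero_mul]
    have h2 : ‖mulMat X V‖ ^ 2 = 1 := by linarith
    exact (pow_eq_one_iff_of_nonneg (norm_nonneg _) two_ne_zero).1 h2

/-! ### Gradient of the Lagrangian. -/

/-- Taking the `j`-th column, as a continuous linear map. -/
noncomputable def colL (n k : ℕ) (j : Fin k) : RMat n k →L[ℝ] EuclideanSpace ℝ (Fin n) :=
  LinearMap.toContinuousLinearMap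
    { toFun := fun X => col X j
      map_add' := fun _ _ => rfl
      map_smul' := fun _ _ => rfl }

/-- Right multiplication by `V`, as a continuous linear map. -/
noncomputable def mulL (n : ℕ) {k r : ℕ} (V : RMat k r) : RMat n k →L[ℝ] RMat n r :=
  LinearMap.toContinuousLinearMap
    { toFun := fun X => mulMat X V
      map_add' := fun X Y => by
        ext p
        simp [mulMat, ofMat, toMat, Matrix.mul_apply, add_mul, Finset.sum_add_distrib]
      map_smul' := fun c X => by
        ext p
        simp [mulMat, ofMat, toMat, Matrix.mul_apply, Finset.mul_sum, mul_assoc] }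

theorem inner_mulMat {n k r : ℕ} (X D : RMat n k) (V : RMat k r) :
    inner ℝ (mulMat X V) (mulMat D V) = ∑ i, ∑ j,
      (∑ j', X (i, j') * (toMat V * (toMat V).transpose) j' j) * D (i, j) := by
  simp only [PiLp.inner_apply, Fintype.sum_prod_type]
  refine Finset.sum_congr rfl fun i _ => ?_
  simp only [mulMat, ofMat, toMat, Matrix.mul_apply, Matrix.of_apply, Matrix.transpose_apply,
    RCLike.inner_apply, conj_trivial]
  simp_rw [Finset.sum_mul_sum, Finset.mul_sum, Finset.sum_mul]
  rw [Finset.sum_comm]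
  refine Finset.sum_congr rfl fun j _ => ?_
  rw [Finset.sum_comm]
  refine Finset.sum_congr rfl fun j' _ => Finset.sum_congr rfl fun a _ => ?_
  ring

/-- The gradient of the Lagrangian at a matrix `X` with `‖X V‖ = 1`. -/
noncomputable def lagrangianGrad {n k r : ℕ} (f : RMat n k → ℝ) (V : RMat k r)
    (Λ : Fin k → ℝ) (Z : RMat n k) (lam : ℝ) (X : RMat n k) : RMat n k :=
  WithLp.toLp 2 fun p => gradient f X p - 2 * Λ p.2 * X p - Z p +
    lam * ∑ j', X (p.1, j') * (toMat V * (toMat V).transpose) j' p.2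

theorem inner_eq_sum {n k : ℕ} (A B : RMat n k) :
    inner ℝ A B = ∑ i, ∑ j, A (i, j) * B (i, j) := by
  simp [PiLp.inner_apply, Fintype.sum_prod_type, mul_comm]

theorem inner_col {n k : ℕ} (A B : RMat n k) (j : Fin k) :
    inner ℝ (col A j) (col B j) = ∑ i, A (i, j) * B (i, j) := by
  simp [PiLp.inner_apply, col, mul_comm]

theorem hasGradientAt_lagrangian {n k r : ℕ} {f : RMat n k → ℝ} {V : RMat k r}
    {X : RMat n k} (hf : DifferentiableAt ℝ f X) (hX : ‖mulMat X V‖ = 1)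
    (Λ : Fin k → ℝ) (Z : RMat n k) (lam : ℝ) :
    HasGradientAt (lagrangian f V Λ Z lam) (lagrangianGrad f V Λ Z lam X) X := by
  rw [hasGradientAt_iff_hasFDerivAt]
  have h1 := hf.hasGradientAt.hasFDerivAt
  have h2 : HasFDerivAt (fun Y : RMat n k => ∑ j, Λ j * (‖colL n k j Y‖ ^ 2 - 1)) _ X :=
    HasFDerivAt.fun_sum fun j (_ : j ∈ Finset.univ) =>
      (((colL n k j).hasFDerivAt (x := X)).norm_sq.sub_const 1).const_mul (Λ j)
  have h3 : HasFDerivAt (fun Y : RMat n k => (inner ℝ Z Y : ℝ)) (innerSL ℝ Z) X :=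
    (innerSL ℝ Z).hasFDerivAt
  -- The norm is differentiated as the root of its square, which is nonzero at `X`.
  have h4 := (((mulL n V).hasFDerivAt (x := X)).norm_sq.sqrt
    (by change ‖mulMat X V‖ ^ 2 ≠ 0; rw [hX]; norm_num)).sub_const 1 |>.const_mul lam
  have h5 := ((h1.sub h2).sub h3).add h4
  refine (h5.congr_of_eventuallyEq (Eventually.of_forall fun Y => ?_)).congr_fderiv ?_
  · simp only [Pi.add_apply, Pi.sub_apply, Real.sqrt_sq (norm_nonneg _)]
    rfl
  · ext D
    have e2 : ∀ Y, mulL n V Y = mulMat Y V := fun _ => rfl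
    have e3 : ∀ j Y, colL n k j Y = col Y j := fun _ _ => rfl
    simp only [hX, add_apply, sub_apply, sum_apply, smul_apply,
      ContinuousLinearMap.comp_apply, innerSL_apply_apply, InnerProductSpace.toDual_apply_apply,
      e2, e3, inner_mulMat, inner_col, one_pow, Real.sqrt_one, smul_eq_mul, nsmul_eq_mul]
    rw [inner_eq_sum (gradient f X), inner_eq_sum Z, inner_eq_sum (lagrangianGrad f V Λ Z lam X)]
    simp only [lagrangianGrad, Finset.mul_sum (s := (Finset.univ : Finset (Fin n)))]
    rw [Finset.sum_comm (s := (Finset.univ : Finset (Fin k)))]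
    simp only [← Finset.sum_sub_distrib, ← Finset.sum_add_distrib]
    refine Finset.sum_congr rfl fun i _ => ?_
    have e4 : ∀ S : ℝ, lam * (1 / (2 * 1) * (((2 : ℕ) : ℝ) * S)) = lam * S := fun S => by
      push_cast; ring
    rw [e4, Finset.mul_sum, ← Finset.sum_add_distrib]
    refine Finset.sum_congr rfl fun j _ => ?_
    push_cast
    ring

theorem isLagrangeMultiplier_iff {n k r : ℕ} {f : RMat n k → ℝ} {V : RMat k r}
    {X : RMat n k} (hf : DifferentiableAt ℝ f X) (hX : X ∈ feasibleSet V)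
    {Λ : Fin k → ℝ} {Z : RMat n k} {lam : ℝ} :
    IsLagrangeMultiplier f V X Λ Z lam ↔
      (∀ i j, 0 ≤ Z (i, j)) ∧ (∀ i j, X (i, j) * Z (i, j) = 0) ∧
      ∀ i j, gradient f X (i, j) - 2 * Λ j * X (i, j) - Z (i, j) +
        lam * ∑ j', X (i, j') * (toMat V * (toMat V).transpose) j' j = 0 := by
  have hg := hasGradientAt_lagrangian hf hX.2 Λ Z lam
  constructor
  · intro h
    refine ⟨h.dual_nonneg, h.complementary, fun i j => ?_⟩
    exact congrArg (fun A : RMat n k => A (i, j)) (hg.unique h.stationary)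
  · rintro ⟨h1, h2, h3⟩
    refine ⟨fun i j => (hX.1 j).2 i, h1, h2, ?_⟩
    have : lagrangianGrad f V Λ Z lam X = 0 := by
      ext p
      exact h3 p.1 p.2
    rwa [this] at hg

/-! ### First-order conditions from column curves. -/

theorem hasDerivAt_nonneg_of_eventually_ge {g : ℝ → ℝ} {g' x : ℝ} (h : HasDerivAt g g' x)
    (hge : ∀ᶠ t in 𝓝[>] 0, g x ≤ g (x + t)) : 0 ≤ g' := by
  refine ge_of_tendsto h.tendsto_slope_zero_right ?_
  filter_upwards [hge, self_mem_nhdsWithin] with t ht h0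
  exact mul_nonneg (inv_nonneg.2 (le_of_lt h0)) (sub_nonneg.2 ht)

/-- The curve obtained from `X` by adding `t * s` to its `(i, j)` entry and multiplying the `j`-th
column by the factor which makes it a unit vector again. -/
noncomputable def columnCurve {n k : ℕ} (X : RMat n k) (i : Fin n) (j : Fin k) (s t : ℝ) :
    RMat n k :=
  WithLp.toLp 2 fun p => if p.2 = j then
    (√(1 + 2 * t * s * X (i, j) + t ^ 2 * s ^ 2))⁻¹ * (X p + if p.1 = i then t * s else 0)
    else X p

theorem columnCurve_zero {n k : ℕ} (X : RMat n k) (i : Fin n) (j : Fin k) (s : ℝ) :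
    columnCurve X i j s 0 = X := by
  ext p
  simp [columnCurve]

theorem hasDerivAt_columnCurve {n k : ℕ} (X : RMat n k) (i : Fin n) (j : Fin k) (s : ℝ) :
    HasDerivAt (columnCurve X i j s) (WithLp.toLp 2 fun p => if p.2 = j then
      -(s * X (i, j)) * X p + (if p.1 = i then s else 0) else 0) 0 := by
  have hN : HasDerivAt (fun t : ℝ => 1 + 2 * t * s * X (i, j) + t ^ 2 * s ^ 2)
      (2 * s * X (i, j)) 0 := by
    have h1 := (((hasDerivAt_id (0 : ℝ)).const_mul 2).mul_const s).mul_const (X (i, j))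
    have h2 := (hasDerivAt_pow 2 (0 : ℝ)).mul_const (s ^ 2)
    exact (((h1.const_add 1).add h2).congr_of_eventuallyEq
      (Eventually.of_forall fun _ => rfl)).congr_deriv (by simp)
  have hq : HasDerivAt (fun t : ℝ => (√(1 + 2 * t * s * X (i, j) + t ^ 2 * s ^ 2))⁻¹)
      (-(s * X (i, j))) 0 := by
    have h1 := (hN.sqrt (by simp)).fun_inv (by simp)
    refine h1.congr_deriv ?_
    simp
    ring
  have hpi : HasDerivAt (fun t : ℝ => fun p : Fin n × Fin k => columnCurve X i j s t p)
      (fun p => if p.2 = j then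
        -(s * X (i, j)) * X p + (if p.1 = i then s else 0) else 0) 0 := by
    rw [hasDerivAt_pi]
    intro p
    by_cases hp : p.2 = j
    · simp only [columnCurve, hp, if_true]
      have h1 : HasDerivAt (fun t : ℝ => X p + if p.1 = i then t * s else 0)
          (if p.1 = i then s else 0) 0 := by
        split_ifs
        · simpa using ((hasDerivAt_id (0 : ℝ)).mul_const s).const_add (X p)
        · simpa using hasDerivAt_const (0 : ℝ) (X p)
      refine (hq.fun_mul h1).congr_deriv ?_
      simp
    · simp only [columnCurve, hp, if_false]
      exact hasDerivAt_const _ _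
  exact (PiLp.hasFDerivAt_toLp (𝕜 := ℝ) 2 _).comp_hasDerivAt (0 : ℝ) hpi

/-- The radicand is the squared norm of the perturbed column, and `hrow` keeps the supports disjoint
when entry `(i, j)` becomes positive. -/
theorem columnCurve_mem_feasibleSet {n k r : ℕ} {V : RMat k r} (hV : ‖V‖ = 1)
    (hVpos : ∀ i j, 0 < (toMat V * (toMat V).transpose) i j) {X : RMat n k}
    (hX : X ∈ feasibleSet V) {i : Fin n} {j : Fin k} (hrow : ∀ j', j' ≠ j → X (i, j') = 0)
    {s t : ℝ} (hpos : 0 < 1 + 2 * t * s * X (i, j) + t ^ 2 * s ^ 2) (hij : 0 ≤ X (i, j) + t * s) :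
    columnCurve X i j s t ∈ feasibleSet V := by
  obtain ⟨hX1, hX2⟩ := (mem_feasibleSet_iff hV hVpos).1 hX
  rw [mem_feasibleSet_iff hV hVpos]
  refine ⟨fun j' => ⟨?_, fun i' => ?_⟩, fun i' a b hab => ?_⟩
  · by_cases hj : j' = j
    · subst hj
      rw [← pow_eq_one_iff_of_nonneg (norm_nonneg _) two_ne_zero, norm_col_sq]
      simp only [columnCurve, if_true, mul_pow, inv_pow, Real.sq_sqrt hpos.le, ← Finset.mul_sum]
      rw [inv_mul_eq_one₀ hpos.ne']
      have h1 : ∀ i', (X (i', j') + if i' = i then t * s else 0) ^ 2 =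
          X (i', j') ^ 2 + if i' = i then 2 * t * s * X (i, j') + t ^ 2 * s ^ 2 else 0 := by
        intro i'
        split_ifs with h
        · rw [h]; ring
        · ring
      simp only [h1, Finset.sum_add_distrib, ← norm_col_sq, (hX1 j').1]
      simp
      ring
    · rw [← (hX1 j').1]
      congr 1
      ext i'
      simp [col, columnCurve, hj]
  · by_cases hj : j' = j
    · subst hj
      simp only [columnCurve, if_true]
      refine mul_nonneg (inv_nonneg.2 (Real.sqrt_nonneg _)) ?_
      split_ifs with h
      · rw [h]; exact hij
      · simpa using (hX1 j').2 i'
    · simpa [columnCurve, hj] using (hX1 j').2 i'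
  · have hz : ∀ b, b ≠ j → (X (i', j) + if i' = i then t * s else 0) * X (i', b) = 0 := by
      intro b hb
      split_ifs with h
      · rw [h, hrow b hb, mul_zero]
      · rw [add_zero, hX2 i' j b (Ne.symm hb)]
    by_cases ha : a = j
    · subst ha
      have hb : b ≠ a := Ne.symm hab
      simp only [columnCurve, hb, if_true, if_false]
      rw [mul_assoc, hz b hb, mul_zero]
    · by_cases hb : b = j
      · subst hb
        simp only [columnCurve, ha, if_true, if_false]
        rw [mul_left_comm, mul_comm (X (i', a)), hz a ha, mul_zero]
      · simpa [columnCurve, ha, hb] using hX2 i' a b hab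

theorem gradient_entry_of_isLocalMinOn {n k r : ℕ} {V : RMat k r} (hV : ‖V‖ = 1)
    (hVpos : ∀ i j, 0 < (toMat V * (toMat V).transpose) i j) {f : RMat n k → ℝ} {X : RMat n k}
    (hf : DifferentiableAt ℝ f X) (hX : X ∈ feasibleSet V)
    (hmin : IsLocalMinOn f (feasibleSet V) X) {i : Fin n} {j : Fin k}
    (hrow : ∀ j', j' ≠ j → X (i, j') = 0) {s : ℝ} (hs : 0 < X (i, j) ∨ 0 ≤ s) :
    0 ≤ s * (gradient f X (i, j) -
      X (i, j) * inner ℝ (col X j) (col (gradient f X) j)) := by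
  have hc := hasDerivAt_columnCurve X i j s
  have hf' := hf.hasGradientAt.hasFDerivAt
  rw [← columnCurve_zero X i j s] at hf'
  have hd := hf'.comp_hasDerivAt (0 : ℝ) hc
  rw [columnCurve_zero] at hd
  have hnonneg := hasDerivAt_nonneg_of_eventually_ge hd ?_
  · rw [InnerProductSpace.toDual_apply_apply, inner_eq_sum, Finset.sum_comm,
      Finset.sum_eq_single_of_mem j (Finset.mem_univ j) (fun b _ hb => by simp [hb])] at hnonneg
    convert hnonneg using 1
    simp only [if_true, inner_col, mul_add, Finset.sum_add_distrib, mul_sub, Finset.mul_sum]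
    simp only [mul_ite, mul_zero, Finset.sum_ite_eq', Finset.mem_univ, if_true]
    rw [sub_eq_add_neg, add_comm, ← Finset.sum_neg_distrib]
    congr 1
    · exact Finset.sum_congr rfl fun _ _ => by ring
    · ring
  · have hXnn := (hX.1 j).2 i
    have hcont : Tendsto (fun t : ℝ => 1 + 2 * t * s * X (i, j) + t ^ 2 * s ^ 2) (𝓝 0) (𝓝 1) := by
      have : Continuous fun t : ℝ => 1 + 2 * t * s * X (i, j) + t ^ 2 * s ^ 2 := by fun_prop
      simpa using this.tendsto 0
    have hpos : ∀ᶠ t in 𝓝[>] (0 : ℝ), 0 < 1 + 2 * t * s * X (i, j) + t ^ 2 * s ^ 2 :=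
      nhdsWithin_le_nhds (hcont.eventually (lt_mem_nhds one_pos))
    have hij : ∀ᶠ t in 𝓝[>] (0 : ℝ), 0 ≤ X (i, j) + t * s := by
      rcases hs with h | h
      · have hc2 : Tendsto (fun t : ℝ => X (i, j) + t * s) (𝓝 0) (𝓝 (X (i, j))) := by
          have : Continuous fun t : ℝ => X (i, j) + t * s := by fun_prop
          simpa using this.tendsto 0
        exact nhdsWithin_le_nhds ((hc2.eventually (lt_mem_nhds h)).mono fun _ h => h.le)
      · filter_upwards [self_mem_nhdsWithin] with t ht
        exact add_nonneg hXnn (mul_nonneg (le_of_lt ht) h)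
    have hev : ∀ᶠ Y in 𝓝 X, Y ∈ feasibleSet V → f X ≤ f Y := eventually_nhdsWithin_iff.1 hmin
    have hct := hc.continuousAt.tendsto
    rw [columnCurve_zero] at hct
    filter_upwards [hpos, hij, nhdsWithin_le_nhds (hct.eventually hev)] with t h1 h2 h3
    simp only [Function.comp_apply, zero_add, columnCurve_zero]
    exact h3 (columnCurve_mem_feasibleSet hV hVpos hX hrow h1 h2)

/-- Stationarity on the support of a local minimizer. -/
theorem gradient_eq_of_pos {n k r : ℕ} {V : RMat k r} (hV : ‖V‖ = 1)
    (hVpos : ∀ i j, 0 < (toMat V * (toMat V).transpose) i j) {f : RMat n k → ℝ} {X : RMat n k}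
    (hf : DifferentiableAt ℝ f X) (hX : X ∈ feasibleSet V)
    (hmin : IsLocalMinOn f (feasibleSet V) X) {i : Fin n} {j : Fin k} (hij : 0 < X (i, j)) :
    gradient f X (i, j) = X (i, j) * inner ℝ (col X j) (col (gradient f X) j) := by
  have hrow : ∀ j', j' ≠ j → X (i, j') = 0 := fun j' hj' =>
    (mul_eq_zero.1 (((mem_feasibleSet_iff hV hVpos).1 hX).2 i j' j hj')).resolve_right hij.ne'
  -- A positive entry may move both ways, so the inequality becomes an equality.
  have h1 := gradient_entry_of_isLocalMinOn hV hVpos hf hX hmin hrow (s := 1) (.inl hij)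
  have h2 := gradient_entry_of_isLocalMinOn hV hVpos hf hX hmin hrow (s := -1) (.inl hij)
  linarith

theorem gradient_nonneg_of_row_eq_zero {n k r : ℕ} {V : RMat k r} (hV : ‖V‖ = 1)
    (hVpos : ∀ i j, 0 < (toMat V * (toMat V).transpose) i j) {f : RMat n k → ℝ} {X : RMat n k}
    (hf : DifferentiableAt ℝ f X) (hX : X ∈ feasibleSet V)
    (hmin : IsLocalMinOn f (feasibleSet V) X) {i : Fin n} (hi : ∀ j, X (i, j) = 0) (j : Fin k) :
    0 ≤ gradient f X (i, j) := by
  simpa [hi j] using gradient_entry_of_isLocalMinOn hV hVpos hf hX hmin (j := j)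
    (fun j' _ => hi j') (s := 1) (.inr zero_le_one)

/-! ### Existence of multipliers. -/

theorem exists_isLagrangeMultiplier {n k r : ℕ} {V : RMat k r} (hV : ‖V‖ = 1)
    (hVpos : ∀ i j, 0 < (toMat V * (toMat V).transpose) i j) {f : RMat n k → ℝ} {X : RMat n k}
    (hf : DifferentiableAt ℝ f X) (hX : X ∈ feasibleSet V)
    (hmin : IsLocalMinOn f (feasibleSet V) X) :
    ∃ (Λ : Fin k → ℝ) (Z : RMat n k) (lam : ℝ), IsLagrangeMultiplier f V X Λ Z lam := by
  have hnn : ∀ i j, 0 ≤ X (i, j) := fun i j => (hX.1 j).2 i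
  set M := toMat V * (toMat V).transpose with hM
  set S : Fin n × Fin k → ℝ := fun p => ∑ j', X (p.1, j') * M j' p.2 with hS
  -- The sum dominates every ratio; terms with `S p = 0` are `0` by convention and play no role.
  set lam : ℝ := ∑ p, |gradient f X p / S p| with hlam
  have hSnn : ∀ p, 0 ≤ S p := fun p =>
    Finset.sum_nonneg fun j' _ => mul_nonneg (hnn _ _) (hVpos _ _).le
  have hlamS : ∀ p, 0 < S p → 0 ≤ gradient f X p + lam * S p := by
    intro p hp
    have h1 : |gradient f X p / S p| ≤ lam :=
      Finset.single_le_sum (f := fun p => |gradient f X p / S p|)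
        (fun _ _ => abs_nonneg _) (Finset.mem_univ p)
    have h2 : -lam ≤ gradient f X p / S p := by linarith [neg_abs_le (gradient f X p / S p)]
    rw [le_div_iff₀ hp] at h2
    linarith
  -- `Λ` solves the stationarity equation on the support, where `S` reduces to `X (i, j) * M j j`;
  -- off the support `Z` absorbs what is left.
  refine ⟨fun j => (inner ℝ (col X j) (col (gradient f X) j) + lam * M j j) / 2,
    WithLp.toLp 2 fun p => if X p = 0 then gradient f X p + lam * S p else 0, lam,
    (isLagrangeMultiplier_iff hf hX).2 ⟨fun i j => ?_, fun i j => ?_, fun i j => ?_⟩⟩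
  · change 0 ≤ if X (i, j) = 0 then gradient f X (i, j) + lam * S (i, j) else 0
    split_ifs with h
    · rcases (hSnn (i, j)).lt_or_eq with hp | hp
      · exact hlamS _ hp
      · rw [← hp, mul_zero, add_zero]
        refine gradient_nonneg_of_row_eq_zero hV hVpos hf hX hmin (fun j' => ?_) j
        have := (Finset.sum_eq_zero_iff_of_nonneg
          (fun j' _ => mul_nonneg (hnn i j') (hVpos j' j).le)).1 hp.symm j' (Finset.mem_univ _)
        exact (mul_eq_zero.1 this).resolve_right (hVpos j' j).ne'
    · exact le_rfl
  · change X (i, j) * (if X (i, j) = 0 then _ else _) = 0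
    split_ifs with h
    · rw [h, zero_mul]
    · exact mul_zero _
  · change _ - _ - (if X (i, j) = 0 then gradient f X (i, j) + lam * S (i, j) else 0) +
      lam * S (i, j) = 0
    split_ifs with h
    · rw [h]; ring
    · have hij : 0 < X (i, j) := lt_of_le_of_ne (hnn i j) (Ne.symm h)
      have hSij : S (i, j) = X (i, j) * M j j :=
        Finset.sum_eq_single_of_mem j (Finset.mem_univ _) fun b _ hb => by
          rw [(mul_eq_zero.1 (((mem_feasibleSet_iff hV hVpos).1 hX).2 i b j hb)).resolve_right h,
            zero_mul]
      rw [hSij, gradient_eq_of_pos hV hVpos hf hX hmin hij]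
      ring

/-! ### Second-order Taylor expansion. -/

/-- Second-order expansion along a segment, with the remainder expressed through the first-order
remainder of the gradient. -/
theorem exists_segment_expansion {E : Type*} [NormedAddCommGroup E] [InnerProductSpace ℝ E]
    [CompleteSpace E] {f : E → ℝ} (hf : Differentiable ℝ f) (x h : E) (H : E →L[ℝ] E) :
    ∃ s ∈ Set.Ioo (0 : ℝ) 1, f (x + h) - f x = inner ℝ (gradient f x) h +
      inner ℝ (H h) h / 2 +
      inner ℝ (gradient f (x + s • h) - gradient f x - H (s • h)) h := by
  have hd : ∀ s : ℝ, HasDerivAt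
      (fun s : ℝ => f (x + s • h) - s ^ 2 * (inner ℝ (H h) h / 2))
      (inner ℝ (gradient f (x + s • h)) h - 2 * s * (inner ℝ (H h) h / 2)) s := by
    intro s
    have h1 : HasDerivAt (fun s : ℝ => x + s • h) h s := by
      simpa using ((hasDerivAt_id s).smul_const h).const_add x
    have h2 := (hf (x + s • h)).hasGradientAt.hasFDerivAt.comp_hasDerivAt s h1
    simp only [InnerProductSpace.toDual_apply_apply] at h2
    exact ((h2.sub ((hasDerivAt_pow 2 s).mul_const (inner ℝ (H h) h / 2))).congr_of_eventuallyEq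
      (Eventually.of_forall fun _ => rfl)).congr_deriv (by simp)
  -- Subtracting the quadratic model first lets the mean value theorem leave only the gradient's
  -- first-order remainder.
  obtain ⟨s, hs, e⟩ := exists_hasDerivAt_eq_slope _ _ (zero_lt_one' ℝ)
    (fun s _ => (hd s).continuousAt.continuousWithinAt) (fun s _ => hd s)
  refine ⟨s, hs, ?_⟩
  simp only [one_smul, zero_smul, add_zero, sub_zero, div_one] at e
  rw [inner_sub_left, inner_sub_left, map_smul, real_inner_smul_left]
  linarith

/-- Second-order Taylor expansion along a sequence approaching `x` in the limiting direction
`d`. -/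
theorem tendsto_second_order_quotient {E : Type*} [NormedAddCommGroup E] [InnerProductSpace ℝ E]
    [CompleteSpace E] {f : E → ℝ} (hf : ContDiff ℝ 2 f) (x d : E) {α : ℕ → ℝ} {u : ℕ → E}
    (hα : ∀ l, 0 < α l) (hα0 : Tendsto α atTop (𝓝 0)) (hu : Tendsto u atTop (𝓝 d)) :
    Tendsto (fun l => (f (x + α l • u l) - f x - α l * inner ℝ (gradient f x) (u l)) / α l ^ 2)
      atTop (𝓝 (inner ℝ (fderiv ℝ (gradient f) x d) d / 2)) := by
  have hfd : Differentiable ℝ f := hf.differentiable (by norm_num)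
  have hgd : DifferentiableAt ℝ (gradient f) x := by
    have h1 : ContDiff ℝ 1 (fderiv ℝ f) := hf.fderiv_right (by norm_num)
    exact ((InnerProductSpace.toDual ℝ E).symm.toContinuousLinearEquiv.differentiable.comp
      (h1.differentiable (by norm_num))) x
  set H := fderiv ℝ (gradient f) x with hH
  choose s hs e using fun l => exists_segment_expansion hfd x (α l • u l) H
  have hsu : Tendsto (fun l => s l • α l • u l) atTop (𝓝 0) := by
    have h1 : Tendsto (fun l => α l • u l) atTop (𝓝 0) := by simpa using hα0.smul hu
    refine squeeze_zero_norm (fun l => ?_) (tendsto_norm_zero.comp h1)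
    rw [norm_smul, Real.norm_eq_abs, abs_of_pos (hs l).1]
    exact mul_le_of_le_one_left (norm_nonneg _) (hs l).2.le
  have hlo := (hasFDerivAt_iff_isLittleO_nhds_zero.1 hgd.hasFDerivAt).comp_tendsto hsu
  -- As `s` and `u` are bounded, the remainder is `o(α)`; pairing it with `α l • u l` gives `o(α²)`.
  have hlo2 : (fun l => gradient f (x + s l • α l • u l) - gradient f x - H (s l • α l • u l))
      =o[atTop] α := by
    refine hlo.trans_isBigO ?_
    have hub : (fun l => u l) =O[atTop] (fun _ => (1 : ℝ)) := hu.isBigO_one ℝ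
    have hsb : s =O[atTop] (fun _ => (1 : ℝ)) :=
      Asymptotics.isBigO_of_le _ fun l => by
        simpa [abs_of_pos (hs l).1] using (hs l).2.le
    have := hsb.smul ((Asymptotics.isBigO_refl α atTop).smul hub)
    simp only [smul_eq_mul, mul_one, one_mul] at this
    exact this
  have hrem : Tendsto (fun l => (α l)⁻¹ • (gradient f (x + s l • α l • u l) - gradient f x -
      H (s l • α l • u l))) atTop (𝓝 0) := by
    refine (Asymptotics.isLittleO_one_iff ℝ).1 ?_
    have := (Asymptotics.isBigO_refl (fun l => (α l)⁻¹) atTop).smul_isLittleO hlo2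
    refine this.congr_right fun l => ?_
    simp [(hα l).ne']
  have hlim := (((H.continuous.tendsto d).comp hu).inner (𝕜 := ℝ) hu).div_const 2 |>.add
    (hrem.inner (𝕜 := ℝ) hu)
  rw [inner_zero_left, add_zero] at hlim
  refine hlim.congr fun l => ?_
  have hne := (hα l).ne'
  rw [sub_eq_iff_eq_add.1 (e l)]
  simp only [Function.comp_apply, map_smul, real_inner_smul_left, real_inner_smul_right]
  field_simp
  ring

/-! ### Independence of the multiplier. -/

/-- On a zero row of `X`, every multiplier matrix equals the gradient. -/
theorem IsLagrangeMultiplier.eq_gradient {n k r : ℕ} {f : RMat n k → ℝ} {V : RMat k r}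
    {X : RMat n k} (hf : DifferentiableAt ℝ f X) (hX : X ∈ feasibleSet V)
    {Λ : Fin k → ℝ} {Z : RMat n k} {lam : ℝ} (h : IsLagrangeMultiplier f V X Λ Z lam)
    {i : Fin n} (hi : ∀ j, X (i, j) = 0) (j : Fin k) : Z (i, j) = gradient f X (i, j) := by
  have := ((isLagrangeMultiplier_iff hf hX).1 h).2.2 i j
  simp only [hi, mul_zero, zero_mul, Finset.sum_const_zero] at this
  linarith

theorem tendsto_add_smul {n k : ℕ} (X D : RMat n k) {α : ℕ → ℝ} {Ds : ℕ → RMat n k}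
    (hα : Tendsto α atTop (𝓝 0)) (hDs : Tendsto Ds atTop (𝓝 D)) :
    Tendsto (fun l => X + α l • Ds l) atTop (𝓝 X) := by
  simpa using (hα.smul hDs).const_add X

theorem eventually_pos_of_tendsto {n k : ℕ} {X : RMat n k} {Y : ℕ → RMat n k}
    (hY : Tendsto Y atTop (𝓝 X)) :
    ∀ᶠ l in atTop, ∀ i j, 0 < X (i, j) → 0 < Y l (i, j) := by
  simp only [eventually_all]
  intro i j
  have hc : Tendsto (fun l => Y l (i, j)) atTop (𝓝 (X (i, j))) :=
    ((EuclideanSpace.proj (𝕜 := ℝ) (i, j)).continuous.tendsto X).comp hY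
  exact fun h => hc.eventually (lt_mem_nhds h)

/-- Near a feasible `X`, the zero entries in a nonzero row of `X` remain zero in feasible
matrices. -/
theorem entry_eq_zero_of_row_ne_zero {n k r : ℕ} {V : RMat k r} (hV : ‖V‖ = 1)
    (hVpos : ∀ i j, 0 < (toMat V * (toMat V).transpose) i j) {X Y : RMat n k}
    (hX : X ∈ feasibleSet V) (hY : Y ∈ feasibleSet V)
    (hXY : ∀ i j, 0 < X (i, j) → 0 < Y (i, j)) {i : Fin n} {j : Fin k} (hij : X (i, j) = 0)
    (hi : ¬ ∀ j', X (i, j') = 0) : Y (i, j) = 0 := by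
  obtain ⟨j', hj'⟩ := not_forall.1 hi
  have hp : 0 < X (i, j') := lt_of_le_of_ne ((hX.1 j').2 i) (Ne.symm hj')
  have hne : j ≠ j' := by rintro rfl; exact hj' hij
  exact (mul_eq_zero.1 (((mem_feasibleSet_iff hV hVpos).1 hY).2 i j j' hne)).resolve_right
    (hXY i j' hp).ne'

theorem seqNullDirAt_subset {n k r : ℕ} {V : RMat k r} (hV : ‖V‖ = 1)
    (hVpos : ∀ i j, 0 < (toMat V * (toMat V).transpose) i j) {f : RMat n k → ℝ} {X : RMat n k}
    (hf : DifferentiableAt ℝ f X) (hX : X ∈ feasibleSet V)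
    {Λ Λ' : Fin k → ℝ} {Z Z' : RMat n k} {lam lam' : ℝ}
    (h : IsLagrangeMultiplier f V X Λ Z lam) (h' : IsLagrangeMultiplier f V X Λ' Z' lam') :
    seqNullDirAt V X Z ⊆ seqNullDirAt V X Z' := by
  rintro D ⟨α, Ds, hα, hα0, hDs, hY⟩
  obtain ⟨N, hN⟩ := eventually_atTop.1 (eventually_pos_of_tendsto (tendsto_add_smul X D hα0 hDs))
  -- The conditions must hold for every index, so the initial terms are dropped.
  refine ⟨fun l => α (l + N), fun l => Ds (l + N), fun l => hα _,
    hα0.comp (tendsto_add_atTop_nat N), hDs.comp (tendsto_add_atTop_nat N), fun l =>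
    ⟨(hY _).1, fun i j => ⟨fun hZ' => ?_, fun _ => ((hY _).1.1 j).2 i⟩⟩⟩
  have hij : X (i, j) = 0 := (mul_eq_zero.1 (h'.complementary i j)).resolve_right hZ'.ne'
  by_cases hi : ∀ j', X (i, j') = 0
  · refine ((hY _).2 i j).1 ?_
    rwa [h.eq_gradient hf hX hi, ← h'.eq_gradient hf hX hi]
  · exact entry_eq_zero_of_row_ne_zero hV hVpos hX (hY _).1 (hN _ (Nat.le_add_left N l)) hij hi

/-! ### The second-order inequality. -/

theorem inner_col_sub_of_norm_eq {n k : ℕ} {X D : RMat n k} {j : Fin k} {a : ℝ}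
    (h : ‖col (X + a • D) j‖ = ‖col X j‖) :
    a * inner ℝ (col X j) (col D j) = -(a ^ 2 * ‖col D j‖ ^ 2 / 2) := by
  have e : col (X + a • D) j = col X j + a • col D j := rfl
  have h2 := norm_add_sq_real (col X j) (a • col D j)
  rw [← e, h, norm_smul, mul_pow, Real.norm_eq_abs, sq_abs, real_inner_smul_right] at h2
  linarith

theorem inner_rhess {n k : ℕ} (f : RMat n k → ℝ) (X D : RMat n k) :
    inner ℝ D (rhess f X D) = inner ℝ (ehess f X D) D -
      ∑ j, inner ℝ (col X j) (col (gradient f X) j) * ‖col D j‖ ^ 2 := by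
  rw [rhess, inner_sub_right, real_inner_comm, inner_eq_sum D, Finset.sum_comm]
  congr 1
  refine Finset.sum_congr rfl fun j _ => ?_
  rw [norm_col_sq, Finset.mul_sum]
  refine Finset.sum_congr rfl fun i _ => ?_
  simp only [ofMat, Matrix.mul_diagonal, Matrix.diag_apply]
  simp only [Matrix.mul_apply, Matrix.transpose_apply, toMat, Matrix.of_apply, inner_col]
  ring

theorem inner_rhess_nonneg {n k r : ℕ} {V : RMat k r} (hV : ‖V‖ = 1)
    (hVpos : ∀ i j, 0 < (toMat V * (toMat V).transpose) i j) {f : RMat n k → ℝ}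
    (hf : ContDiff ℝ 2 f) {X : RMat n k} (hX : X ∈ feasibleSet V)
    (hmin : IsLocalMinOn f (feasibleSet V) X)
    {Λ : Fin k → ℝ} {Z : RMat n k} {lam : ℝ} (h : IsLagrangeMultiplier f V X Λ Z lam)
    {D : RMat n k} (hD : D ∈ seqNullDirAt V X Z) : 0 ≤ inner ℝ D (rhess f X D) := by
  have hfX : DifferentiableAt ℝ f X := hf.differentiable (by norm_num) X
  obtain ⟨α, Ds, hα, hα0, hDs, hY⟩ := hD
  have hYX := tendsto_add_smul X D hα0 hDs
  set c : Fin k → ℝ := fun j => inner ℝ (col X j) (col (gradient f X) j) with hc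
  have hlow : Tendsto (fun l => (∑ j, c j * ‖col (Ds l) j‖ ^ 2) / 2) atTop
      (𝓝 ((∑ j, c j * ‖col D j‖ ^ 2) / 2)) :=
    (tendsto_finsetSum _ fun j _ =>
      ((((colL n k j).continuous.tendsto D).comp hDs).norm.pow 2).const_mul (c j)).div_const 2
  have hup := tendsto_second_order_quotient hf X D hα hα0 hDs
  have hle := le_of_tendsto_of_tendsto hlow hup ?_
  · rw [inner_rhess]
    exact sub_nonneg.2 ((div_le_div_iff_of_pos_right two_pos).1 hle)
  have hev : ∀ᶠ Y in 𝓝 X, Y ∈ feasibleSet V → f X ≤ f Y := eventually_nhdsWithin_iff.1 hmin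
  filter_upwards [hYX.eventually hev, eventually_pos_of_tendsto hYX] with l hfl hpl
  have hYl := (hY l).1
  -- Off the support both sides vanish: either `Ds l (i, j) = 0`, or the row is zero and the
  -- gradient entry equals `Z (i, j) = 0`.
  have hentry : ∀ i j, gradient f X (i, j) * Ds l (i, j) =
      c j * (X (i, j) * Ds l (i, j)) := by
    intro i j
    rcases ((hX.1 j).2 i).lt_or_eq with hp | hp
    · rw [gradient_eq_of_pos hV hVpos hfX hX hmin hp]
      ring
    · rw [← hp, zero_mul, mul_zero]
      have hzero : (X + α l • Ds l) (i, j) = 0 → Ds l (i, j) = 0 := by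
        intro h0
        have : X (i, j) + α l * Ds l (i, j) = 0 := h0
        rw [← hp, zero_add] at this
        exact (mul_eq_zero.1 this).resolve_left (hα l).ne'
      by_cases hi : ∀ j', X (i, j') = 0
      · rw [← h.eq_gradient hfX hX hi]
        rcases (h.dual_nonneg i j).lt_or_eq with hz | hz
        · rw [hzero (((hY l).2 i j).1 hz), mul_zero]
        · rw [← hz, zero_mul]
      · rw [hzero (entry_eq_zero_of_row_ne_zero hV hVpos hX hYl hpl hp.symm hi), mul_zero]
  have hinner : α l * inner ℝ (gradient f X) (Ds l) =
      -(α l ^ 2 * ((∑ j, c j * ‖col (Ds l) j‖ ^ 2) / 2)) := by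
    have h1 : inner ℝ (gradient f X) (Ds l) = ∑ j, c j * inner ℝ (col X j) (col (Ds l) j) := by
      simp only [inner_eq_sum, hentry]
      rw [Finset.sum_comm]
      simp only [inner_col, Finset.mul_sum]
    rw [h1, Finset.mul_sum, Finset.sum_div, Finset.mul_sum, ← Finset.sum_neg_distrib]
    refine Finset.sum_congr rfl fun j _ => ?_
    rw [mul_left_comm, inner_col_sub_of_norm_eq (((hYl.1 j).1).trans ((hX.1 j).1).symm)]
    ring
  rw [hinner, le_div_iff₀ (pow_pos (hα l) 2)]
  linarith [hfl hYl]

end NonnegOrth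

theorem mainTheorem10 (n k r : ℕ) (hk : 1 ≤ k) (hkn : k ≤ n) (hr : 1 ≤ r) (hrk : r ≤ k)
    (V : NonnegOrth.RMat k r) (hV : ‖V‖ = 1)
    (hVpos : ∀ i j, 0 < (NonnegOrth.toMat V * (NonnegOrth.toMat V).transpose) i j)
    (f : NonnegOrth.RMat n k → ℝ) (hf : ContDiff ℝ 2 f)
    (Xbar : NonnegOrth.RMat n k) (hX : Xbar ∈ NonnegOrth.feasibleSet V)
    (hmin : IsLocalMinOn f (NonnegOrth.feasibleSet V) Xbar) :
    (∃ (Λ : Fin k → ℝ) (Z : NonnegOrth.RMat n k) (lam : ℝ),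
      NonnegOrth.IsLagrangeMultiplier f V Xbar Λ Z lam) ∧
    (∀ (Λ : Fin k → ℝ) (Z : NonnegOrth.RMat n k) (lam : ℝ),
      NonnegOrth.IsLagrangeMultiplier f V Xbar Λ Z lam →
        NonnegOrth.seqNullDirAt V Xbar Z = NonnegOrth.seqNullDir f V Xbar) ∧
    ∀ D ∈ NonnegOrth.seqNullDir f V Xbar,
      0 ≤ inner ℝ D (NonnegOrth.rhess f Xbar D) := by
  have hfX : DifferentiableAt ℝ f Xbar := hf.differentiable (by norm_num) Xbar
  refine ⟨NonnegOrth.exists_isLagrangeMultiplier hV hVpos hfX hX hmin, ?_, ?_⟩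
  · intro Λ Z lam h
    refine Set.Subset.antisymm (fun D hD => ⟨Λ, Z, lam, h, hD⟩) ?_
    rintro D ⟨Λ', Z', lam', h', hD⟩
    exact NonnegOrth.seqNullDirAt_subset hV hVpos hfX hX h' h hD
  · rintro D ⟨Λ, Z, lam, h, hD⟩
    exact NonnegOrth.inner_rhess_nonneg hV hVpos hf hX hmin h hD
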